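/- Let $\mathcal{H}$ be a separable complex Hilbert space. Let $\mathbb{P}(\mathcal{H})=\{|\psi\rangle\langle\psi| : \psi\in\mathcal{H},\ \|\psi\|=1\}$ be the set of pure states (rank-one orthogonal projections) and, for $p\in\{1,2\}$, let $\mathcal{T}_p(\mathcal{H})$ be the real vector space of bounded self-adjoint operators $X$ on $\mathcal{H}$ with $\|X\|_p:=(\operatorname{Tr}|X|^p)^{1/p}<\infty$, so that $\mathbb{P}(\mathcal{H})\subseteq\mathcal{T}_1(\mathcal{H})$. Let $\varepsilon\in\mathbb{R}$ and let $f:\mathbb{P}(\mathcal{H})\to\mathcal{T}_2(\mathcal{H})$ be a map such that $$\left|\operatorname{Tr} f(X)f(Y)-\operatorname{Tr}XY\right|\le\varepsilon\qquad\text{for all }X,Y\in\mathbb{P}(\mathcal{H}).$$ (i) For every $A\in\mathcal{T}_2(\mathcal{H})$ with $\|A\|_2\le 1$ there is a real-linear map $T_A:\mathcal{T}_1(\mathcal{H})\to\mathcal{T}_2(\mathcal{H})$ such that $$\left|\operatorname{Tr}\big[A\big(f(X)-T_A(X)\big)\big]\right|\le 4\sqrt{\varepsilon}\qquad\text{for all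 }X\in\mathbb{P}(\mathcal{H}).$$ (ii) If $\mathcal{H}$ has finite dimension $d$ (that is, $\mathcal{H}=\mathbb{C}^d$ up to unitary equivalence), there is a real-linear map $T:\mathcal{T}_1(\mathcal{H})\to\mathcal{T}_2(\mathcal{H})$ such that $$\|f(X)-T(X)\|_2\le 4d\sqrt{\varepsilon}\qquad\text{for all }X\in\mathbb{P}(\mathcal{H}).$$ -/

import Mathlib

open scoped ENNReal InnerProductSpace

noncomputable section

namespace Schatten

/-! ### Trace and Schatten norms of bounded operators on a complex Hilbert space -/

section Definitions

variable (H : Type*) [NormedAddCommGroup H] [InnerProductSpace ℂ H] [CompleteSpace H]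

/-- The index set of a fixed orthonormal (Hilbert) basis of `H`. -/
def basisIndex : Set H := (exists_hilbertBasis ℂ H).choose

/-- A fixed orthonormal (Hilbert) basis of `H`. The notions below do not depend on this choice,
see `posTrace_eq_tsum` and `hasSum_trace_mul`. -/
def basis : HilbertBasis (basisIndex H) ℂ H := (exists_hilbertBasis ℂ H).choose_spec.choose

variable {H}

/-- The trace, with values in `[0, ∞]`, of a positive bounded operator. -/
def posTrace (P : H →L[ℂ] H) : ℝ≥0∞ :=
  ∑' i, ENNReal.ofReal (⟪basis H i, P (basis H i)⟫_ℂ).re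

/-- The trace of a trace class operator (for instance, of a product of two Hilbert–Schmidt
operators). -/
def trace (X : H →L[ℂ] H) : ℂ := ∑' i, ⟪basis H i, X (basis H i)⟫_ℂ

/-- The Schatten norm `‖X‖_p = (Tr |X|^p)^(1/p)`, with values in `[0, ∞]`; the absolute value
`|X| = (X* X)^(1/2)` and its powers are given by the continuous functional calculus. -/
def schattenNorm (p : ℝ) (X : H →L[ℂ] H) : ℝ≥0∞ := posTrace (CFC.abs X ^ p) ^ (1 / p)

variable (H)

/-- The set underlying the hermitian Schatten class `T_p(H)`. -/
def hermitianClass (p : ℝ) : Set (H →L[ℂ] H) :=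
  {X | IsSelfAdjoint X ∧ schattenNorm p X < ∞}

/-- The set `ℙ(H)` of pure states `|ψ⟩⟨ψ|`, `‖ψ‖ = 1`. -/
def pureStates : Set (H →L[ℂ] H) :=
  {X | ∃ ψ : H, ‖ψ‖ = 1 ∧ X = InnerProductSpace.rankOne ℂ ψ ψ}

end Definitions

/-! ### The facts that make `T_1(H)` and `T_2(H)` real vector spaces, and that the trace does not
depend on the basis -/

section Facts

variable {H : Type*} [NormedAddCommGroup H] [InnerProductSpace ℂ H] [CompleteSpace H]
variable {ι κ : Type*}

theorem tsum_enorm_inner_sq (b : HilbertBasis ι ℂ H) (x : H) :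
    ∑' i, ‖⟪b i, x⟫_ℂ‖ₑ ^ 2 = ‖x‖ₑ ^ 2 := by
  have h := (Complex.hasSum_re (b.hasSum_inner_mul_inner x x))
  have h2 : ∀ i, (⟪x, b i⟫_ℂ * ⟪b i, x⟫_ℂ).re = ‖⟪b i, x⟫_ℂ‖ ^ 2 := by
    intro i
    rw [← inner_conj_symm x (b i), ← Complex.normSq_eq_conj_mul_self, Complex.ofReal_re,
      Complex.normSq_eq_norm_sq]
  simp only [h2] at h
  have h3 : (⟪x, x⟫_ℂ).re = ‖x‖ ^ 2 := by
    rw [inner_self_eq_norm_sq_to_K]; norm_cast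
  rw [h3] at h
  have h4 := ENNReal.ofReal_tsum_of_nonneg (fun i => by positivity) h.summable
  rw [h.tsum_eq] at h4
  simp only [← ofReal_norm, ← ENNReal.ofReal_pow (norm_nonneg _)]
  exact h4.symm

theorem tsum_enorm_sq_adjoint (b : HilbertBasis ι ℂ H) (c : HilbertBasis κ ℂ H)
    (A : H →L[ℂ] H) : ∑' i, ‖A (b i)‖ₑ ^ 2 = ∑' j, ‖(star A) (c j)‖ₑ ^ 2 := by
  calc ∑' i, ‖A (b i)‖ₑ ^ 2 = ∑' i, ∑' j, ‖⟪c j, A (b i)⟫_ℂ‖ₑ ^ 2 := by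
        simp only [tsum_enorm_inner_sq]
    _ = ∑' j, ∑' i, ‖⟪b i, (star A) (c j)⟫_ℂ‖ₑ ^ 2 := by
        rw [ENNReal.tsum_comm]
        congr 1; ext j; congr 1; ext i
        rw [ContinuousLinearMap.star_eq_adjoint, ContinuousLinearMap.adjoint_inner_right,
          ← inner_conj_symm (A (b i)) (c j), RCLike.enorm_conj]
    _ = _ := by simp only [tsum_enorm_inner_sq]

theorem tsum_enorm_sq_eq (b : HilbertBasis ι ℂ H) (c : HilbertBasis κ ℂ H)
    (A : H →L[ℂ] H) : ∑' i, ‖A (b i)‖ₑ ^ 2 = ∑' j, ‖A (c j)‖ₑ ^ 2 := by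
  rw [tsum_enorm_sq_adjoint b c, tsum_enorm_sq_adjoint c c A]

theorem ofReal_inner_star_mul_self (A : H →L[ℂ] H) (x : H) :
    ENNReal.ofReal (⟪x, (star A * A) x⟫_ℂ).re = ‖A x‖ₑ ^ 2 := by
  rw [mul_apply_eq_comp, ContinuousLinearMap.star_eq_adjoint,
    ContinuousLinearMap.adjoint_inner_right, inner_self_eq_norm_sq_to_K, ← ofReal_norm,
    ← ENNReal.ofReal_pow (norm_nonneg _)]
  norm_cast

theorem posTrace_star_mul_self (A : H →L[ℂ] H) :
    posTrace (star A * A) = ∑' i, ‖A (basis H i)‖ₑ ^ 2 := by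
  simp only [posTrace, ofReal_inner_star_mul_self]

theorem posTrace_eq_sqrt {P : H →L[ℂ] H} (hP : 0 ≤ P) :
    posTrace P = ∑' i, ‖CFC.sqrt P (basis H i)‖ₑ ^ 2 := by
  rw [← posTrace_star_mul_self, (CFC.sqrt_nonneg P).isSelfAdjoint.star_eq,
    CFC.sqrt_mul_sqrt_self P hP]

/-- The trace of a positive operator does not depend on the basis. -/
theorem posTrace_eq_tsum {P : H →L[ℂ] H} (hP : 0 ≤ P) (b : HilbertBasis ι ℂ H) :
    posTrace P = ∑' i, ENNReal.ofReal (⟪b i, P (b i)⟫_ℂ).re := by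
  rw [posTrace_eq_sqrt hP, tsum_enorm_sq_eq (basis H) b]
  congr 1; ext i
  rw [← ofReal_inner_star_mul_self, (CFC.sqrt_nonneg P).isSelfAdjoint.star_eq,
    CFC.sqrt_mul_sqrt_self P hP]

theorem inner_re_nonneg {P : H →L[ℂ] H} (hP : 0 ≤ P) (x : H) : 0 ≤ (⟪x, P x⟫_ℂ).re :=
  ((ContinuousLinearMap.nonneg_iff_isPositive P).1 hP).re_inner_nonneg_right x

theorem inner_re_mono {P Q : H →L[ℂ] H} (h : P ≤ Q) (x : H) :
    (⟪x, P x⟫_ℂ).re ≤ (⟪x, Q x⟫_ℂ).re := by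
  have := inner_re_nonneg (sub_nonneg.2 h) x
  rw [sub_apply, inner_sub_right, Complex.sub_re] at this
  linarith

theorem posTrace_mono {P Q : H →L[ℂ] H} (h : P ≤ Q) : posTrace P ≤ posTrace Q :=
  ENNReal.tsum_le_tsum fun _ => ENNReal.ofReal_le_ofReal (inner_re_mono h _)

theorem posTrace_add {P Q : H →L[ℂ] H} (hP : 0 ≤ P) (hQ : 0 ≤ Q) :
    posTrace (P + Q) = posTrace P + posTrace Q := by
  rw [posTrace, posTrace, posTrace, ← ENNReal.tsum_add]
  congr 1; ext i
  rw [add_apply, inner_add_right, Complex.add_re,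
    ENNReal.ofReal_add (inner_re_nonneg hP _) (inner_re_nonneg hQ _)]

theorem sum_inner_mul_le {P G : H →L[ℂ] H} (hP : 0 ≤ P) (hG : ‖G‖ ≤ 1) (hfin : posTrace P < ∞)
    (F : Finset (basisIndex H)) :
    ∑ i ∈ F, (⟪basis H i, (P * G) (basis H i)⟫_ℂ).re ≤ (posTrace P).toReal := by
  set S := CFC.sqrt P with hS
  have hSs : star S = S := (CFC.sqrt_nonneg P).isSelfAdjoint.star_eq
  have hSS : S * S = P := CFC.sqrt_mul_sqrt_self P hP
  have h1 : ∑' i, ‖S (basis H i)‖ₑ ^ 2 = posTrace P := (posTrace_eq_sqrt hP).symm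
  have h2 : ∑' i, ‖(S * G) (basis H i)‖ₑ ^ 2 ≤ posTrace P := by
    rw [tsum_enorm_sq_adjoint (basis H) (basis H), star_mul, hSs, ← h1]
    refine ENNReal.tsum_le_tsum fun i => ?_
    gcongr
    rw [← ofReal_norm, ← ofReal_norm]
    refine ENNReal.ofReal_le_ofReal ?_
    rw [mul_apply_eq_comp]
    calc _ ≤ ‖star G‖ * ‖S (basis H i)‖ := (star G).le_opNorm _
      _ ≤ 1 * ‖S (basis H i)‖ := by
        rw [norm_star]; gcongr
      _ = _ := one_mul _
  have key : ∀ A : H →L[ℂ] H, ∑' i, ‖A (basis H i)‖ₑ ^ 2 ≤ posTrace P →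
      ∑ i ∈ F, ‖A (basis H i)‖ ^ 2 ≤ (posTrace P).toReal := by
    intro A hA
    have h3 := (ENNReal.sum_le_tsum F).trans hA
    have h4 := ENNReal.toReal_mono hfin.ne h3
    rw [ENNReal.toReal_sum (fun i _ => by finiteness)] at h4
    simpa using h4
  have hpt : ∀ i, (⟪basis H i, (P * G) (basis H i)⟫_ℂ).re ≤
      (‖S (basis H i)‖ ^ 2 + ‖(S * G) (basis H i)‖ ^ 2) / 2 := by
    intro i
    have : ⟪basis H i, (P * G) (basis H i)⟫_ℂ = ⟪S (basis H i), (S * G) (basis H i)⟫_ℂ := by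
      rw [← hSS, mul_assoc, mul_apply_eq_comp]
      nth_rw 1 [← hSs]
      rw [ContinuousLinearMap.star_eq_adjoint, ContinuousLinearMap.adjoint_inner_right]
    rw [this]
    have h5 := (Complex.re_le_norm _).trans (norm_inner_le_norm (𝕜 := ℂ) (S (basis H i))
      ((S * G) (basis H i)))
    nlinarith [sq_nonneg (‖S (basis H i)‖ - ‖(S * G) (basis H i)‖)]
  calc _ ≤ ∑ i ∈ F, (‖S (basis H i)‖ ^ 2 + ‖(S * G) (basis H i)‖ ^ 2) / 2 :=
        Finset.sum_le_sum fun i _ => hpt i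
    _ = (∑ i ∈ F, ‖S (basis H i)‖ ^ 2 + ∑ i ∈ F, ‖(S * G) (basis H i)‖ ^ 2) / 2 := by
        rw [← Finset.sum_add_distrib, Finset.sum_div]
    _ ≤ _ := by linarith [key S h1.le, key (S * G) h2]

/-- A difference of positive operators of finite trace is trace class. -/
theorem posTrace_abs_sub_lt_top {P Q : H →L[ℂ] H} (hP : 0 ≤ P) (hQ : 0 ≤ Q)
    (hP' : posTrace P < ∞) (hQ' : posTrace Q < ∞) : posTrace (CFC.abs (P - Q)) < ∞ := by
  set Z := P - Q with hZdef
  have hZ : IsSelfAdjoint Z := hP.isSelfAdjoint.sub hQ.isSelfAdjoint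
  set C := (posTrace P).toReal + (posTrace Q).toReal with hC
  have hfinsum : ∀ F : Finset (basisIndex H),
      ∑ i ∈ F, (⟪basis H i, CFC.abs Z (basis H i)⟫_ℂ).re ≤ C := by
    intro F
    refine le_of_forall_pos_le_add fun δ hδ => ?_
    obtain ⟨e, he, heF⟩ : ∃ e : ℝ, 0 < e ∧ e * F.card ≤ δ := by
      refine ⟨δ / (F.card + 1), by positivity, ?_⟩
      rw [div_mul_eq_mul_div, div_le_iff₀ (by positivity)]
      nlinarith
    set g : ℝ → ℝ := fun x => x / (|x| + e) with hg
    have hpos : ∀ x : ℝ, 0 < |x| + e := fun x => by positivity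
    have hgc : Continuous g := continuous_id.div (continuous_abs.add continuous_const)
      fun x => (hpos x).ne'
    set G := cfc g Z with hG
    have hG1 : ‖G‖ ≤ 1 := by
      refine norm_cfc_le zero_le_one fun x _ => ?_
      rw [Real.norm_eq_abs, hg]
      simp only [abs_div, abs_of_pos (hpos x)]
      rw [div_le_one (hpos x)]
      linarith
    have hle : CFC.abs Z ≤ Z * G + algebraMap ℝ (H →L[ℂ] H) e := by
      have e1 : Z * G + algebraMap ℝ (H →L[ℂ] H) e = cfc (fun x => x * g x + e) Z := by
        rw [cfc_add (a := Z) (fun x => x * g x) (fun _ => e) (by fun_prop) (by fun_prop),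
          cfc_mul (a := Z) (fun x => x) g (by fun_prop) (by fun_prop), cfc_id' ℝ Z,
          cfc_const e Z]
      rw [e1, CFC.abs_eq_cfc_norm Z hZ]
      refine cfc_mono (fun x _ => ?_) (by fun_prop) (by fun_prop)
      rw [Real.norm_eq_abs, hg]
      have : x * (x / (|x| + e)) = |x| ^ 2 / (|x| + e) := by
        rw [sq_abs]; ring
      simp only [this]
      rw [← sub_le_iff_le_add, le_div_iff₀ (hpos x)]
      nlinarith
    have hterm : ∀ i, (⟪basis H i, CFC.abs Z (basis H i)⟫_ℂ).re ≤
        (⟪basis H i, (P * G) (basis H i)⟫_ℂ).re + (⟪basis H i, (Q * (-G)) (basis H i)⟫_ℂ).re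
          + e := by
      intro i
      refine (inner_re_mono hle (basis H i)).trans_eq ?_
      have e2 : Z * G + algebraMap ℝ (H →L[ℂ] H) e =
          P * G + Q * (-G) + algebraMap ℝ (H →L[ℂ] H) e := by
        rw [hZdef, sub_mul, mul_neg, sub_eq_add_neg]
      have hn : ‖basis H i‖ = 1 := (basis H).orthonormal.1 i
      have e3 : (⟪basis H i, (algebraMap ℝ (H →L[ℂ] H) e) (basis H i)⟫_ℂ).re = e := by
        rw [Algebra.algebraMap_eq_smul_one, smul_apply,
          one_apply_eq_self, inner_smul_right_eq_smul, inner_self_eq_norm_sq_to_K, hn]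
        simp
      rw [e2, add_apply, add_apply, inner_add_right,
        inner_add_right, Complex.add_re, Complex.add_re, e3]
    calc _ ≤ _ := Finset.sum_le_sum fun i _ => hterm i
      _ ≤ _ := by
        rw [Finset.sum_add_distrib, Finset.sum_add_distrib, Finset.sum_const, nsmul_eq_mul]
        have h1 := sum_inner_mul_le hP hG1 hP' F
        have h2 := sum_inner_mul_le hQ (G := -G) (by rwa [norm_neg]) hQ' F
        linarith
  refine lt_of_le_of_lt ?_ (ENNReal.ofReal_lt_top (r := C))
  rw [posTrace, ENNReal.tsum_eq_iSup_sum]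
  refine iSup_le fun F => ?_
  rw [← ENNReal.ofReal_sum_of_nonneg fun i _ => inner_re_nonneg (CFC.abs_nonneg Z) _]
  exact ENNReal.ofReal_le_ofReal (hfinsum F)

theorem schattenNorm_one (X : H →L[ℂ] H) : schattenNorm 1 X = posTrace (CFC.abs X) := by
  rw [schattenNorm, CFC.rpow_one _ (CFC.abs_nonneg X)]
  simp

theorem schattenNorm_two (X : H →L[ℂ] H) :
    schattenNorm 2 X = (∑' i, ‖X (basis H i)‖ₑ ^ 2) ^ (1 / 2 : ℝ) := by
  have h := CFC.rpow_natCast (CFC.abs X) 2 (CFC.abs_nonneg X)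
  rw [Nat.cast_ofNat] at h
  rw [schattenNorm, h, CFC.abs_sq, posTrace_star_mul_self]

theorem schattenNorm_two_lt_top_iff (X : H →L[ℂ] H) :
    schattenNorm 2 X < ∞ ↔ ∑' i, ‖X (basis H i)‖ₑ ^ 2 < ∞ := by
  rw [schattenNorm_two, ENNReal.rpow_lt_top_iff_of_pos (by norm_num)]

theorem mem_hermitianClass_one_iff {X : H →L[ℂ] H} :
    X ∈ hermitianClass H 1 ↔ IsSelfAdjoint X ∧ posTrace (CFC.abs X) < ∞ := by
  rw [hermitianClass, Set.mem_ofPred_eq, schattenNorm_one]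

theorem mem_hermitianClass_two_iff {X : H →L[ℂ] H} :
    X ∈ hermitianClass H 2 ↔ IsSelfAdjoint X ∧ ∑' i, ‖X (basis H i)‖ₑ ^ 2 < ∞ := by
  rw [hermitianClass, Set.mem_ofPred_eq, schattenNorm_two_lt_top_iff]

theorem posTrace_smul {r : ℝ} (hr : 0 ≤ r) (P : H →L[ℂ] H) :
    posTrace (r • P) = ENNReal.ofReal r * posTrace P := by
  rw [posTrace, posTrace, ← ENNReal.tsum_mul_left]
  congr 1; ext i
  rw [smul_apply, inner_smul_right_eq_smul, Complex.smul_re, smul_eq_mul,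
    ENNReal.ofReal_mul hr]

theorem add_mem_one {X Y : H →L[ℂ] H} (hX : X ∈ hermitianClass H 1)
    (hY : Y ∈ hermitianClass H 1) : X + Y ∈ hermitianClass H 1 := by
  rw [mem_hermitianClass_one_iff] at *
  obtain ⟨hX, hX'⟩ := hX
  obtain ⟨hY, hY'⟩ := hY
  refine ⟨hX.add hY, ?_⟩
  have e : X + Y = (X⁺ + Y⁺) - (X⁻ + Y⁻) := by
    nth_rw 1 [← CFC.posPart_sub_negPart X hX, ← CFC.posPart_sub_negPart Y hY]
    abel
  rw [← CFC.posPart_add_negPart X hX,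
    posTrace_add (CFC.posPart_nonneg X) (CFC.negPart_nonneg X), ENNReal.add_lt_top] at hX'
  rw [← CFC.posPart_add_negPart Y hY,
    posTrace_add (CFC.posPart_nonneg Y) (CFC.negPart_nonneg Y), ENNReal.add_lt_top] at hY'
  rw [e]
  refine posTrace_abs_sub_lt_top (add_nonneg (CFC.posPart_nonneg X) (CFC.posPart_nonneg Y))
    (add_nonneg (CFC.negPart_nonneg X) (CFC.negPart_nonneg Y)) ?_ ?_
  · rw [posTrace_add (CFC.posPart_nonneg X) (CFC.posPart_nonneg Y)]
    exact ENNReal.add_lt_top.2 ⟨hX'.1, hY'.1⟩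
  · rw [posTrace_add (CFC.negPart_nonneg X) (CFC.negPart_nonneg Y)]
    exact ENNReal.add_lt_top.2 ⟨hX'.2, hY'.2⟩

theorem smul_mem_one (r : ℝ) {X : H →L[ℂ] H} (hX : X ∈ hermitianClass H 1) :
    r • X ∈ hermitianClass H 1 := by
  rw [mem_hermitianClass_one_iff] at *
  refine ⟨(IsSelfAdjoint.all r).smul hX.1, ?_⟩
  rw [CFC.abs_smul, posTrace_smul (norm_nonneg r)]
  exact ENNReal.mul_lt_top ENNReal.ofReal_lt_top hX.2

theorem tsum_enorm_sq_add_lt_top {X Y : H →L[ℂ] H} (b : HilbertBasis ι ℂ H)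
    (hX : ∑' i, ‖X (b i)‖ₑ ^ 2 < ∞) (hY : ∑' i, ‖Y (b i)‖ₑ ^ 2 < ∞) :
    ∑' i, ‖(X + Y) (b i)‖ₑ ^ 2 < ∞ := by
  have h : ∀ i, ‖(X + Y) (b i)‖ₑ ^ 2 ≤ 2 * (‖X (b i)‖ₑ ^ 2 + ‖Y (b i)‖ₑ ^ 2) := by
    intro i
    rw [add_apply]
    have h1 := enorm_add_le (X (b i)) (Y (b i))
    have h2 := ENNReal.rpow_add_le_mul_rpow_add_rpow ‖X (b i)‖ₑ ‖Y (b i)‖ₑ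
      (p := 2) (by norm_num)
    norm_num at h2
    exact (pow_le_pow_left' h1 2).trans h2
  refine (ENNReal.tsum_le_tsum h).trans_lt ?_
  rw [ENNReal.tsum_mul_left, ENNReal.tsum_add]
  exact ENNReal.mul_lt_top (by simp) (ENNReal.add_lt_top.2 ⟨hX, hY⟩)

theorem tsum_enorm_sq_smul_lt_top (z : ℂ) {X : H →L[ℂ] H} (b : HilbertBasis ι ℂ H)
    (hX : ∑' i, ‖X (b i)‖ₑ ^ 2 < ∞) : ∑' i, ‖(z • X) (b i)‖ₑ ^ 2 < ∞ := by
  simp only [smul_apply, enorm_smul, mul_pow]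
  rw [ENNReal.tsum_mul_left]
  exact ENNReal.mul_lt_top (by finiteness) hX

theorem add_mem_two {X Y : H →L[ℂ] H} (hX : X ∈ hermitianClass H 2)
    (hY : Y ∈ hermitianClass H 2) : X + Y ∈ hermitianClass H 2 := by
  rw [mem_hermitianClass_two_iff] at *
  exact ⟨hX.1.add hY.1, tsum_enorm_sq_add_lt_top _ hX.2 hY.2⟩

theorem smul_mem_two (r : ℝ) {X : H →L[ℂ] H} (hX : X ∈ hermitianClass H 2) :
    r • X ∈ hermitianClass H 2 := by
  rw [mem_hermitianClass_two_iff] at *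
  refine ⟨(IsSelfAdjoint.all r).smul hX.1, ?_⟩
  simp only [smul_apply, enorm_smul, mul_pow]
  rw [ENNReal.tsum_mul_left]
  exact ENNReal.mul_lt_top (by finiteness) hX.2

theorem pureStates_subset_one : pureStates H ⊆ hermitianClass H 1 := by
  rintro X ⟨ψ, hψ, rfl⟩
  have hpos : 0 ≤ InnerProductSpace.rankOne ℂ ψ ψ :=
    (ContinuousLinearMap.nonneg_iff_isPositive _).2 (InnerProductSpace.isPositive_rankOne_self ψ)
  rw [mem_hermitianClass_one_iff]
  refine ⟨hpos.isSelfAdjoint, ?_⟩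
  have h : posTrace (InnerProductSpace.rankOne ℂ ψ ψ) = ∑' i, ‖⟪basis H i, ψ⟫_ℂ‖ₑ ^ 2 := by
    rw [posTrace]
    congr 1; ext i
    rw [InnerProductSpace.rankOne_apply, inner_smul_right, ← inner_conj_symm ψ (basis H i),
      ← Complex.normSq_eq_conj_mul_self, Complex.ofReal_re, Complex.normSq_eq_norm_sq,
      ← ofReal_norm, ENNReal.ofReal_pow (norm_nonneg _)]
  rw [CFC.abs_of_nonneg _ hpos, h, tsum_enorm_inner_sq]
  finiteness

theorem hasSum_norm_sq {A : H →L[ℂ] H} (b : HilbertBasis ι ℂ H)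
    (hA : ∑' i, ‖A (basis H i)‖ₑ ^ 2 < ∞) :
    HasSum (fun i => ‖A (b i)‖ ^ 2) (∑' i, ‖A (basis H i)‖ₑ ^ 2).toReal := by
  rw [tsum_enorm_sq_eq (basis H) b] at hA ⊢
  have h := (ENNReal.summable_toReal hA.ne).hasSum
  rw [← ENNReal.tsum_toReal_eq (fun i => by finiteness)] at h
  simpa using h

theorem hasSum_inner_mul {A B : H →L[ℂ] H} (hA : A ∈ hermitianClass H 2)
    (hB : B ∈ hermitianClass H 2) (t : ℂ → ℂ)
    (ht : t = fun z => (((∑' i, ‖(A + z • B) (basis H i)‖ₑ ^ 2).toReal : ℝ) : ℂ))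
    (b : HilbertBasis ι ℂ H) : HasSum (fun i => ⟪b i, (A * B) (b i)⟫_ℂ)
      ((t 1 - t (-1) + (t (-Complex.I) - t Complex.I) * Complex.I) / 4) := by
  rw [mem_hermitianClass_two_iff] at hA hB
  have hs : ∀ z : ℂ, ∑' i, ‖(A + z • B) (basis H i)‖ₑ ^ 2 < ∞ := fun z =>
    tsum_enorm_sq_add_lt_top _ hA.2 (tsum_enorm_sq_smul_lt_top z _ hB.2)
  have h : ∀ z : ℂ, HasSum (fun i => ((‖(A + z • B) (b i)‖ ^ 2 : ℝ) : ℂ)) (t z) := by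
    intro z
    rw [ht]
    exact Complex.hasSum_ofReal.2 (hasSum_norm_sq b (hs z))
  have h' := ((((h 1).sub (h (-1))).add (((h (-Complex.I)).sub (h Complex.I)).mul_right
    Complex.I)).div_const 4)
  refine (congrArg (fun g => HasSum g _) (funext fun i => ?_)).mpr h'
  have e : ⟪b i, (A * B) (b i)⟫_ℂ = ⟪A (b i), B (b i)⟫_ℂ := by
    rw [mul_apply_eq_comp]
    nth_rw 1 [← hA.1.star_eq]
    rw [ContinuousLinearMap.star_eq_adjoint, ContinuousLinearMap.adjoint_inner_right]
  rw [e, inner_eq_sum_norm_sq_div_four]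
  simp [sub_eq_add_neg]

/-- The trace of a product of two hermitian Hilbert–Schmidt operators converges in every
orthonormal basis and does not depend on the basis. -/
theorem hasSum_trace_mul {A B : H →L[ℂ] H} (hA : A ∈ hermitianClass H 2)
    (hB : B ∈ hermitianClass H 2) (b : HilbertBasis ι ℂ H) :
    HasSum (fun i => ⟪b i, (A * B) (b i)⟫_ℂ) (trace (A * B)) := by
  rw [trace, (hasSum_inner_mul hA hB _ rfl (basis H)).tsum_eq]
  exact hasSum_inner_mul hA hB _ rfl b

end Facts

/-! ### The hermitian Schatten classes `T_1(H)` and `T_2(H)` as real vector spaces -/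

section Classes

variable (H : Type*) [NormedAddCommGroup H] [InnerProductSpace ℂ H] [CompleteSpace H]

/-- The real vector space `T_1(H)` of hermitian trace class operators. -/
def T1 : Submodule ℝ (H →L[ℂ] H) where
  carrier := hermitianClass H 1
  add_mem' := add_mem_one
  zero_mem' := by
    rw [mem_hermitianClass_one_iff]
    simp [posTrace]
  smul_mem' r _ := smul_mem_one r

/-- The real vector space `T_2(H)` of hermitian Hilbert–Schmidt operators. -/
def T2 : Submodule ℝ (H →L[ℂ] H) where
  carrier := hermitianClass H 2
  add_mem' := add_mem_two
  zero_mem' := by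
    rw [mem_hermitianClass_two_iff]
    simp
  smul_mem' r _ := smul_mem_two r

variable {H}

/-- A pure state, regarded as an element of `T_1(H)`. -/
def pureToT1 (X : pureStates H) : T1 H := ⟨X, pureStates_subset_one X.2⟩

end Classes

end Schatten

end

/-!
Two families of vectors `u`, `w` whose Gram matrices differ entrywise by at most `ε` satisfy the
same linear relations up to an error: `‖∑ cᵢ wᵢ‖² - ‖∑ cᵢ uᵢ‖²` is at most `ε (∑ |cᵢ|)²`, so
`∑ cᵢ uᵢ = 0` forces `‖∑ cᵢ wᵢ‖ ≤ √ε ∑ |cᵢ|`. By Hahn–Banach on the free vector space over the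
index set, a scalar function which respects linear relations up to `δ` times the `ℓ¹` norm of the
coefficients is uniformly within `δ` of a linear functional; applied to `s ↦ ⟪a, w s⟫` this
linearizes every coordinate of `w` with error `‖a‖ √ε`, and assembling the coordinates in an
orthonormal basis of an `n`-dimensional space costs a factor `√n`. The theorem is the case of pure
states and their images under `f`, in `T_2(H)` with the inner product `Tr AB`, whose dimension is
at most `d²`.
-/

section Linearization

open Finsupp Module

variable {𝕜 M S E F G : Type*} [RCLike 𝕜] [AddCommGroup M] [Module 𝕜 M] [AddCommGroup E]
  [Module 𝕜 E] [NormedAddCommGroup F] [InnerProductSpace 𝕜 F] [NormedAddCommGroup G]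
  [InnerProductSpace 𝕜 G]

theorem exists_dual_norm_sub_comp_le (p : Seminorm 𝕜 M) (V : M →ₗ[𝕜] E) (g : Dual 𝕜 M)
    (hg : ∀ x ∈ V.ker, ‖g x‖ ≤ p x) : ∃ l : Dual 𝕜 E, ∀ x, ‖g x - l (V x)‖ ≤ p x := by
  obtain ⟨g', hg'g, hg'p⟩ := Dual.exists_extension_of_le_seminorm V.ker (g.domRestrict V.ker)
    (p := p) fun x => hg x x.2
  obtain ⟨l, hl⟩ : g - g' ∈ V.dualMap.range := by
    rw [LinearMap.range_dualMap_eq_dualAnnihilator_ker, Submodule.mem_dualAnnihilator]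
    exact fun x hx => sub_eq_zero.2 (hg'g ⟨x, hx⟩).symm
  refine ⟨l, fun x => ?_⟩
  have hlx : l (V x) = g x - g' x := LinearMap.congr_fun hl x
  rw [hlx, sub_sub_cancel]
  exact hg'p x

variable (𝕜 S) in
/-- The `ℓ¹` norm of the coefficients of a formal linear combination, as a seminorm on the free
module over `S`. -/
noncomputable def l1Seminorm : Seminorm 𝕜 (S →₀ 𝕜) :=
  .of (fun c => c.sum fun _ a => ‖a‖)
    (fun c c' => by
      classical
      rw [sum_of_support_subset (c + c') support_add _ (by simp),
        sum_of_support_subset c Finset.subset_union_left _ (by simp),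
        sum_of_support_subset c' Finset.subset_union_right _ (by simp),
        ← Finset.sum_add_distrib]
      exact Finset.sum_le_sum fun i _ => norm_add_le _ _)
    (fun r c => by
      rw [sum_smul_index (by simp)]
      simp only [norm_mul, Finsupp.sum, Finset.mul_sum])

theorem l1Seminorm_apply (c : S →₀ 𝕜) : l1Seminorm 𝕜 S c = c.sum fun _ a => ‖a‖ := rfl

theorem l1Seminorm_single (s : S) (a : 𝕜) : l1Seminorm 𝕜 S (single s a) = ‖a‖ := by
  rw [l1Seminorm_apply, sum_single_index (by simp)]

theorem exists_dual_norm_sub_le {v : S → E} {g : S → 𝕜} {δ : ℝ} (hδ : 0 ≤ δ)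
    (hg : ∀ c ∈ (linearCombination 𝕜 v).ker, ‖linearCombination 𝕜 g c‖ ≤ δ * l1Seminorm 𝕜 S c) :
    ∃ l : Dual 𝕜 E, ∀ s, ‖g s - l (v s)‖ ≤ δ := by
  lift δ to NNReal using hδ
  obtain ⟨l, hl⟩ := exists_dual_norm_sub_comp_le (δ • l1Seminorm 𝕜 S)
    (linearCombination 𝕜 v) (linearCombination 𝕜 g) hg
  refine ⟨l, fun s => ?_⟩
  simpa [l1Seminorm_single, NNReal.smul_def] using hl (single s 1)

theorem inner_linearCombination_self (w : S → G) (c : S →₀ 𝕜) :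
    inner 𝕜 (linearCombination 𝕜 w c) (linearCombination 𝕜 w c) =
      ∑ s ∈ c.support, ∑ t ∈ c.support, star (c s) * c t * inner 𝕜 (w s) (w t) := by
  simp only [linearCombination_apply, Finsupp.sum, sum_inner, inner_sum, inner_smul_left,
    inner_smul_right, starRingEnd_apply, Finset.mul_sum]
  rw [Finset.sum_comm]
  exact Finset.sum_congr rfl fun s _ => Finset.sum_congr rfl fun t _ => by ring

theorem norm_inner_linearCombination_self_sub_le {u : S → F} {w : S → G} {ε : ℝ}
    (h : ∀ s t, ‖inner 𝕜 (w s) (w t) - inner 𝕜 (u s) (u t)‖ ≤ ε) (c : S →₀ 𝕜) :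
    ‖inner 𝕜 (linearCombination 𝕜 w c) (linearCombination 𝕜 w c) -
      inner 𝕜 (linearCombination 𝕜 u c) (linearCombination 𝕜 u c)‖ ≤
      ε * l1Seminorm 𝕜 S c ^ 2 := by
  calc
    _ = ‖∑ s ∈ c.support, ∑ t ∈ c.support,
          star (c s) * c t * (inner 𝕜 (w s) (w t) - inner 𝕜 (u s) (u t))‖ := by
      simp only [inner_linearCombination_self, ← Finset.sum_sub_distrib, mul_sub]
    _ ≤ ∑ s ∈ c.support, ∑ t ∈ c.support, ‖c s‖ * ‖c t‖ * ε := by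
      refine norm_sum_le_of_le _ fun s _ => norm_sum_le_of_le _ fun t _ => ?_
      rw [norm_mul, norm_mul, norm_star]
      exact mul_le_mul_of_nonneg_left (h s t) (by positivity)
    _ = ε * l1Seminorm 𝕜 S c ^ 2 := by
      simp only [l1Seminorm_apply, Finsupp.sum, sq, Finset.sum_mul_sum, ← Finset.sum_mul,
        mul_comm ε]

theorem norm_linearCombination_le_of_inner_sub_le {u : S → F} {w : S → G} {ε : ℝ}
    (h : ∀ s t, ‖inner 𝕜 (w s) (w t) - inner 𝕜 (u s) (u t)‖ ≤ ε) {c : S →₀ 𝕜}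
    (hc : linearCombination 𝕜 u c = 0) :
    ‖linearCombination 𝕜 w c‖ ≤ √ε * l1Seminorm 𝕜 S c := by
  have hsq := norm_inner_linearCombination_self_sub_le h c
  rw [hc, inner_zero_left, sub_zero, inner_self_eq_norm_sq_to_K, norm_pow, RCLike.norm_ofReal,
    abs_norm] at hsq
  calc
    ‖linearCombination 𝕜 w c‖ ≤ √(ε * l1Seminorm 𝕜 S c ^ 2) := Real.le_sqrt_of_sq_le hsq
    _ = √ε * l1Seminorm 𝕜 S c := by
      rw [Real.sqrt_mul' _ (sq_nonneg _), Real.sqrt_sq (apply_nonneg _ c)]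

section

variable {v : S → E} {u : S → F} {w : S → G} {ε : ℝ}

theorem exists_dual_norm_inner_sub_le
    (hvu : (linearCombination 𝕜 v).ker ≤ (linearCombination 𝕜 u).ker)
    (h : ∀ s t, ‖inner 𝕜 (w s) (w t) - inner 𝕜 (u s) (u t)‖ ≤ ε) (a : G) :
    ∃ l : Dual 𝕜 E, ∀ s, ‖inner 𝕜 a (w s) - l (v s)‖ ≤ ‖a‖ * √ε := by
  refine exists_dual_norm_sub_le (by positivity) fun c hc => ?_
  calc
    ‖linearCombination 𝕜 (fun s => inner 𝕜 a (w s)) c‖ = ‖inner 𝕜 a (linearCombination 𝕜 w c)‖ :=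
      congrArg norm (apply_linearCombination 𝕜 (innerₛₗ 𝕜 a) w c).symm
    _ ≤ ‖a‖ * ‖linearCombination 𝕜 w c‖ := norm_inner_le_norm _ _
    _ ≤ ‖a‖ * (√ε * l1Seminorm 𝕜 S c) := by
      gcongr
      exact norm_linearCombination_le_of_inner_sub_le h (hvu hc)
    _ = ‖a‖ * √ε * l1Seminorm 𝕜 S c := (mul_assoc _ _ _).symm

theorem exists_linearMap_norm_inner_sub_le
    (hvu : (linearCombination 𝕜 v).ker ≤ (linearCombination 𝕜 u).ker)
    (h : ∀ s t, ‖inner 𝕜 (w s) (w t) - inner 𝕜 (u s) (u t)‖ ≤ ε) (a : G) :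
    ∃ T : E →ₗ[𝕜] G, ∀ s, ‖inner 𝕜 a (w s - T (v s))‖ ≤ ‖a‖ * √ε := by
  obtain ⟨l, hl⟩ := exists_dual_norm_inner_sub_le hvu h a
  rcases eq_or_ne a 0 with rfl | ha
  · exact ⟨0, by simp⟩
  refine ⟨l.smulRight ((inner 𝕜 a a)⁻¹ • a), fun s => (congrArg norm ?_).trans_le (hl s)⟩
  rw [inner_sub_right, LinearMap.smulRight_apply, inner_smul_right, inner_smul_right,
    inv_mul_cancel₀ (inner_self_ne_zero.2 ha), mul_one]

theorem exists_linearMap_norm_sub_le [FiniteDimensional 𝕜 G]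
    (hvu : (linearCombination 𝕜 v).ker ≤ (linearCombination 𝕜 u).ker)
    (h : ∀ s t, ‖inner 𝕜 (w s) (w t) - inner 𝕜 (u s) (u t)‖ ≤ ε) :
    ∃ T : E →ₗ[𝕜] G, ∀ s, ‖w s - T (v s)‖ ≤ √(finrank 𝕜 G) * √ε := by
  let b := stdOrthonormalBasis 𝕜 G
  choose l hl using fun k => exists_dual_norm_inner_sub_le hvu h (b k)
  let T : E →ₗ[𝕜] G := ∑ k, (l k).smulRight (b k)
  have hT (k) (x : E) : inner 𝕜 (b k) (T x) = l k x := by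
    simpa [T] using b.orthonormal.inner_right_fintype (fun k => l k x) k
  refine ⟨T, fun s => ?_⟩
  have hsq : ‖w s - T (v s)‖ ^ 2 ≤ finrank 𝕜 G * √ε ^ 2 :=
    calc
      ‖w s - T (v s)‖ ^ 2 = ∑ k, ‖inner 𝕜 (b k) (w s - T (v s))‖ ^ 2 :=
        (b.sum_sq_norm_inner_right _).symm
      _ ≤ ∑ _k : Fin (finrank 𝕜 G), √ε ^ 2 := by
        gcongr with k
        rw [inner_sub_right, hT]
        simpa using hl k s
      _ = finrank 𝕜 G * √ε ^ 2 := by simp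
  calc
    ‖w s - T (v s)‖ ≤ √(finrank 𝕜 G * √ε ^ 2) := Real.le_sqrt_of_sq_le hsq
    _ = √(finrank 𝕜 G) * √ε := by
      rw [Real.sqrt_mul' _ (sq_nonneg _), Real.sqrt_sq (Real.sqrt_nonneg _)]

end

end Linearization

section ComplexStarModule

open Module

theorem finrank_real_selfAdjoint (A : Type*) [AddCommGroup A] [Module ℂ A] [StarAddMonoid A]
    [StarModule ℂ A] [FiniteDimensional ℂ A] :
    finrank ℝ (selfAdjoint.submodule ℝ A) = finrank ℂ A := by
  let reIm : A →ₗ[ℝ] selfAdjoint A × selfAdjoint A := realPart.prod imaginaryPart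
  have hbij : Function.Bijective reIm := by
    refine ⟨fun x y hxy => ComplexStarModule.ext (congrArg Prod.fst hxy) (congrArg Prod.snd hxy),
      fun ⟨x, y⟩ => ⟨x + Complex.I • (y : A), ?_⟩⟩
    simp [reIm, realPart_I_smul, imaginaryPart_I_smul]
  have hsum := (LinearEquiv.ofBijective reIm hbij).finrank_eq
  have : FiniteDimensional ℝ (selfAdjoint A) :=
    inferInstanceAs (FiniteDimensional ℝ (selfAdjoint.submodule ℝ A))
  have hsa : finrank ℝ (selfAdjoint A) = finrank ℝ (selfAdjoint.submodule ℝ A) := rfl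
  rw [finrank_real_of_complex, finrank_prod, hsa] at hsum
  lia

end ComplexStarModule

namespace Schatten

variable {H : Type*} [NormedAddCommGroup H] [InnerProductSpace ℂ H] [CompleteSpace H]

section HilbertSchmidt

open Module ComplexConjugate

theorem hasSum_inner_apply_apply (A B : T2 H) :
    HasSum (fun i => ⟪(A : H →L[ℂ] H) (basis H i), (B : H →L[ℂ] H) (basis H i)⟫_ℂ)
      (trace ((A : H →L[ℂ] H) * (B : H →L[ℂ] H))) := by
  have hA : IsSelfAdjoint (A : H →L[ℂ] H) := A.2.1
  convert hasSum_trace_mul A.2 B.2 (basis H) using 2 with i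
  exact hA.isSymmetric _ _

theorem conj_trace_mul (A B : T2 H) :
    conj (trace ((A : H →L[ℂ] H) * (B : H →L[ℂ] H))) =
      trace ((B : H →L[ℂ] H) * (A : H →L[ℂ] H)) := by
  have hconj := Complex.hasSum_conj'.2 (hasSum_inner_apply_apply A B)
  simp only [inner_conj_symm] at hconj
  exact hconj.unique (hasSum_inner_apply_apply B A)

theorem trace_add_mul (A A' B : T2 H) :
    trace (((A + A' : T2 H) : H →L[ℂ] H) * (B : H →L[ℂ] H)) =
      trace ((A : H →L[ℂ] H) * (B : H →L[ℂ] H)) + trace ((A' : H →L[ℂ] H) * (B : H →L[ℂ] H)) := by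
  refine (hasSum_inner_apply_apply (A + A') B).unique ?_
  simpa [inner_add_left] using (hasSum_inner_apply_apply A B).add (hasSum_inner_apply_apply A' B)

theorem trace_smul_mul (r : ℝ) (A B : T2 H) :
    trace (((r • A : T2 H) : H →L[ℂ] H) * (B : H →L[ℂ] H)) =
      r * trace ((A : H →L[ℂ] H) * (B : H →L[ℂ] H)) := by
  refine (hasSum_inner_apply_apply (r • A) B).unique ?_
  simpa [inner_smul_left_eq_smul] using (hasSum_inner_apply_apply A B).mul_left (r : ℂ)

theorem hasSum_norm_sq_apply (A : T2 H) :
    HasSum (fun i => ‖(A : H →L[ℂ] H) (basis H i)‖ ^ 2)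
      (trace ((A : H →L[ℂ] H) * (A : H →L[ℂ] H))).re := by
  convert Complex.hasSum_re (hasSum_inner_apply_apply A A) using 2 with i
  exact norm_sq_eq_re_inner (𝕜 := ℂ) _

/-- The Hilbert–Schmidt norms of `A + iB` and of its adjoint `A - iB` agree, and their difference
is the imaginary part of the trace by polarization. -/
theorem trace_mul_im (A B : T2 H) : (trace ((A : H →L[ℂ] H) * (B : H →L[ℂ] H))).im = 0 := by
  have hA : IsSelfAdjoint (A : H →L[ℂ] H) := A.2.1
  have hB : IsSelfAdjoint (B : H →L[ℂ] H) := B.2.1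
  have hadj : ∑' i, ‖((A : H →L[ℂ] H) + Complex.I • (B : H →L[ℂ] H)) (basis H i)‖ₑ ^ 2 =
      ∑' i, ‖((A : H →L[ℂ] H) + (-Complex.I) • (B : H →L[ℂ] H)) (basis H i)‖ₑ ^ 2 := by
    rw [tsum_enorm_sq_adjoint (basis H) (basis H), star_add, star_smul, hA.star_eq, hB.star_eq]
    simp
  rw [trace, (hasSum_inner_mul A.2 B.2 _ rfl (basis H)).tsum_eq, hadj, sub_self, zero_mul,
    add_zero, ← Complex.ofReal_sub]
  norm_cast

theorem eq_zero_of_trace_mul_self_re_eq_zero {A : T2 H}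
    (hA : (trace ((A : H →L[ℂ] H) * (A : H →L[ℂ] H))).re = 0) : A = 0 := by
  have hsum := hasSum_norm_sq_apply A
  rw [hA, hasSum_zero_iff_of_nonneg fun i => by positivity] at hsum
  have hbasis (i) : (A : H →L[ℂ] H) (basis H i) = 0 := by simpa using congrFun hsum i
  refine Subtype.ext (ContinuousLinearMap.ext_on (s := Set.range (basis H)) ?_ ?_)
  · exact Submodule.dense_iff_topologicalClosure_eq_top.2 (basis H).dense_span
  · rintro _ ⟨i, rfl⟩
    exact hbasis i

variable (H) in
/-- The space `T_2(H)` with the inner product `Tr AB`. It is a type synonym because `T2 H` already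
carries the operator norm as a subspace of `H →L[ℂ] H`. -/
def HilbertSchmidt : Type _ := T2 H

noncomputable instance : AddCommGroup (HilbertSchmidt H) := inferInstanceAs (AddCommGroup (T2 H))

noncomputable instance : Module ℝ (HilbertSchmidt H) := inferInstanceAs (Module ℝ (T2 H))

variable (H) in
/-- The identity of `T_2(H)`, as a map to its synonym with the inner product `Tr AB`. -/
noncomputable def toHilbertSchmidt : T2 H ≃ₗ[ℝ] HilbertSchmidt H := LinearEquiv.refl ℝ (T2 H)

/-- The inner product `Tr AB` on `T_2(H)`. -/
noncomputable abbrev HilbertSchmidt.core : InnerProductSpace.Core ℝ (HilbertSchmidt H) where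
  inner A B := (trace (((toHilbertSchmidt H).symm A : H →L[ℂ] H) *
    ((toHilbertSchmidt H).symm B : H →L[ℂ] H))).re
  conj_inner_symm A B := by
    rw [conj_trivial, ← conj_trace_mul, Complex.conj_re]
  re_inner_nonneg A := (hasSum_norm_sq_apply _).nonneg fun i => by positivity
  add_left A A' B := by rw [map_add, trace_add_mul, Complex.add_re]
  smul_left A B r := by rw [map_smul, trace_smul_mul, Complex.re_ofReal_mul, conj_trivial]
  definite A hA := (toHilbertSchmidt H).symm.map_eq_zero_iff.1
    (eq_zero_of_trace_mul_self_re_eq_zero hA)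

noncomputable instance : NormedAddCommGroup (HilbertSchmidt H) :=
  HilbertSchmidt.core.toNormedAddCommGroup

noncomputable instance : InnerProductSpace ℝ (HilbertSchmidt H) :=
  .ofCore HilbertSchmidt.core.toCore

theorem trace_mul_eq_inner (A B : T2 H) :
    trace ((A : H →L[ℂ] H) * (B : H →L[ℂ] H)) =
      (⟪toHilbertSchmidt H A, toHilbertSchmidt H B⟫_ℝ : ℝ) :=
  Complex.ext rfl (trace_mul_im A B)

theorem schattenNorm_two_eq_norm (A : T2 H) :
    schattenNorm 2 (A : H →L[ℂ] H) = ENNReal.ofReal ‖toHilbertSchmidt H A‖ := by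
  have hfin := (mem_hermitianClass_two_iff.1 A.2).2
  have hnorm : (∑' i, ‖(A : H →L[ℂ] H) (basis H i)‖ₑ ^ 2).toReal = ‖toHilbertSchmidt H A‖ ^ 2 :=
    calc
      _ = (trace ((A : H →L[ℂ] H) * (A : H →L[ℂ] H))).re :=
        (hasSum_norm_sq (basis H) hfin).unique (hasSum_norm_sq_apply A)
      _ = ‖toHilbertSchmidt H A‖ ^ 2 := by
        rw [trace_mul_eq_inner, Complex.ofReal_re, real_inner_self_eq_norm_sq]
  rw [schattenNorm_two, ← ENNReal.ofReal_toReal hfin.ne, hnorm,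
    ENNReal.ofReal_rpow_of_nonneg (by positivity) (by norm_num), ← Real.sqrt_eq_rpow,
    Real.sqrt_sq (norm_nonneg _)]

instance [FiniteDimensional ℂ H] : FiniteDimensional ℝ (HilbertSchmidt H) :=
  inferInstanceAs (FiniteDimensional ℝ (T2 H))

theorem finrank_hilbertSchmidt_le [FiniteDimensional ℂ H] :
    finrank ℝ (HilbertSchmidt H) ≤ finrank ℂ H ^ 2 := by
  calc
    finrank ℝ (HilbertSchmidt H) ≤ finrank ℝ (selfAdjoint.submodule ℝ (H →L[ℂ] H)) :=
      Submodule.finrank_mono (s := T2 H) fun _ hA => hA.1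
    _ = finrank ℂ (H →L[ℂ] H) := finrank_real_selfAdjoint _
    _ = finrank ℂ (H →ₗ[ℂ] H) := LinearMap.toContinuousLinearMap.finrank_eq.symm
    _ = finrank ℂ H ^ 2 := by rw [finrank_linearMap, sq]

end HilbertSchmidt

section PureStates

open Finsupp

theorem pureStates_subset_two : pureStates H ⊆ hermitianClass H 2 := by
  rintro X ⟨ψ, hψ, rfl⟩
  rw [mem_hermitianClass_two_iff]
  refine ⟨(InnerProductSpace.isPositive_rankOne_self ψ).isSelfAdjoint, ?_⟩
  have henorm (i) :
      ‖InnerProductSpace.rankOne ℂ ψ ψ (basis H i)‖ₑ = ‖⟪basis H i, ψ⟫_ℂ‖ₑ := by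
    rw [InnerProductSpace.rankOne_apply, ← enorm_norm, norm_smul, hψ, mul_one, enorm_norm,
      ← inner_conj_symm, RCLike.enorm_conj]
  simp only [henorm, tsum_enorm_inner_sq]
  finiteness

/-- A pure state, regarded as an element of `T_2(H)`; the counterpart of `pureToT1`. -/
def pureToT2 (X : pureStates H) : T2 H := ⟨X, pureStates_subset_two X.2⟩

theorem ker_linearCombination_pureToT1_le :
    (linearCombination ℝ (pureToT1 (H := H))).ker ≤
      (linearCombination ℝ (toHilbertSchmidt H ∘ pureToT2)).ker := by
  intro c hc
  have hcoe : (T2 H).subtype (linearCombination ℝ pureToT2 c) =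
      (T1 H).subtype (linearCombination ℝ pureToT1 c) := by
    rw [apply_linearCombination, apply_linearCombination]
    rfl
  rw [LinearMap.mem_ker.1 hc, map_zero, Submodule.subtype_apply, Submodule.coe_eq_zero] at hcoe
  rw [LinearMap.mem_ker, ← LinearEquiv.coe_coe, ← apply_linearCombination, hcoe, map_zero]

theorem norm_inner_toHilbertSchmidt_sub_le {ε : ℝ} {f : pureStates H → T2 H}
    (hf : ∀ X Y : pureStates H, ‖trace ((f X : H →L[ℂ] H) * (f Y : H →L[ℂ] H)) -
      trace ((X : H →L[ℂ] H) * (Y : H →L[ℂ] H))‖ ≤ ε) (X Y : pureStates H) :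
    ‖⟪toHilbertSchmidt H (f X), toHilbertSchmidt H (f Y)⟫_ℝ -
      ⟪toHilbertSchmidt H (pureToT2 X), toHilbertSchmidt H (pureToT2 Y)⟫_ℝ‖ ≤ ε := by
  rw [← Complex.norm_real, Complex.ofReal_sub, ← trace_mul_eq_inner, ← trace_mul_eq_inner]
  exact hf X Y

end PureStates

end Schatten

open Schatten in
theorem theorem1_general {H : Type*} [NormedAddCommGroup H] [InnerProductSpace ℂ H]
    [CompleteSpace H] (ε : ℝ) (f : pureStates H → T2 H)
    (hf : ∀ X Y : pureStates H, ‖trace ((f X : H →L[ℂ] H) * (f Y : H →L[ℂ] H)) -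
      trace ((X : H →L[ℂ] H) * (Y : H →L[ℂ] H))‖ ≤ ε) :
    (∀ A : T2 H, ∃ T : T1 H →ₗ[ℝ] T2 H, ∀ X : pureStates H,
      ‖trace ((A : H →L[ℂ] H) * ((f X : H →L[ℂ] H) - (T (pureToT1 X) : H →L[ℂ] H)))‖ ≤
        (schattenNorm 2 (A : H →L[ℂ] H)).toReal * √ε) ∧
    (FiniteDimensional ℂ H → ∃ T : T1 H →ₗ[ℝ] T2 H, ∀ X : pureStates H,
      schattenNorm 2 ((f X : H →L[ℂ] H) - (T (pureToT1 X) : H →L[ℂ] H)) ≤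
        ENNReal.ofReal (Module.finrank ℂ H * √ε)) := by
  have hgram := norm_inner_toHilbertSchmidt_sub_le hf
  refine ⟨fun A => ?_, fun _ => ?_⟩
  · obtain ⟨T, hT⟩ := exists_linearMap_norm_inner_sub_le (u := toHilbertSchmidt H ∘ pureToT2)
      (w := toHilbertSchmidt H ∘ f) ker_linearCombination_pureToT1_le hgram (toHilbertSchmidt H A)
    refine ⟨(toHilbertSchmidt H).symm ∘ₗ T, fun X => ?_⟩
    rw [← Submodule.coe_sub, trace_mul_eq_inner, Complex.norm_real, schattenNorm_two_eq_norm,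
      ENNReal.toReal_ofReal (norm_nonneg _)]
    exact hT X
  · obtain ⟨T, hT⟩ := exists_linearMap_norm_sub_le (u := toHilbertSchmidt H ∘ pureToT2)
      (w := toHilbertSchmidt H ∘ f) ker_linearCombination_pureToT1_le hgram
    refine ⟨(toHilbertSchmidt H).symm ∘ₗ T, fun X => ?_⟩
    rw [← Submodule.coe_sub, schattenNorm_two_eq_norm]
    refine ENNReal.ofReal_le_ofReal ((hT X).trans ?_)
    gcongr
    exact Real.sqrt_le_left (by positivity) |>.2 (mod_cast finrank_hilbertSchmidt_le)

theorem theorem1 {H : Type*} [NormedAddCommGroup H] [InnerProductSpace ℂ H] [CompleteSpace H]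
    [TopologicalSpace.SeparableSpace H] (ε : ℝ) (f : Schatten.pureStates H → Schatten.T2 H)
    (hf : ∀ X Y : Schatten.pureStates H,
      ‖Schatten.trace ((f X : H →L[ℂ] H) * (f Y : H →L[ℂ] H)) -
        Schatten.trace ((X : H →L[ℂ] H) * (Y : H →L[ℂ] H))‖ ≤ ε) :
    (∀ A : Schatten.T2 H, Schatten.schattenNorm 2 (A : H →L[ℂ] H) ≤ 1 →
      ∃ T : Schatten.T1 H →ₗ[ℝ] Schatten.T2 H, ∀ X : Schatten.pureStates H,
        ‖Schatten.trace ((A : H →L[ℂ] H) *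
          ((f X : H →L[ℂ] H) - (T (Schatten.pureToT1 X) : H →L[ℂ] H)))‖ ≤ 4 * √ε) ∧
    (∀ d : ℕ, FiniteDimensional ℂ H → Module.finrank ℂ H = d →
      ∃ T : Schatten.T1 H →ₗ[ℝ] Schatten.T2 H, ∀ X : Schatten.pureStates H,
        Schatten.schattenNorm 2 ((f X : H →L[ℂ] H) - (T (Schatten.pureToT1 X) : H →L[ℂ] H)) ≤
          ENNReal.ofReal (4 * d * √ε)) := by
  obtain ⟨hdual, hfin⟩ := theorem1_general ε f hf
  constructor
  · intro A hA
    have hA' : (Schatten.schattenNorm 2 (A : H →L[ℂ] H)).toReal ≤ 1 :=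
      ENNReal.toReal_mono ENNReal.one_ne_top hA
    exact (hdual A).imp fun T hT X => (hT X).trans (by gcongr; linarith)
  · rintro _ hH rfl
    exact (hfin hH).imp fun T hT X => (hT X).trans (by gcongr; linarith)
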